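/- Let $\mathcal H_A,\mathcal H_B$ be finite-dimensional Hilbert spaces and let $\mathscr B=\{\mathcal B_x\}_{x=1}^m$ ($m\ge 1$) be a set of orthonormal bases $\mathcal B_x=\{|\psi_{xk}\rangle\}_k$ of $\mathcal H_A$. A density operator $\rho$ on $\mathcal H_A\otimes\mathcal H_B$ is a zero-uncertainty state (ZUS) with respect to $\mathscr B$ if for every $x$ there is a POVM $\{\Pi_{xk}\}_k$ on $\mathcal H_B$ with $\sum_k \operatorname{tr}[\rho(|\psi_{xk}\rangle\langle\psi_{xk}|\otimes \Pi_{xk})]=1$. The transition graph of $\mathscr B$ has the pairs $(x,k)$ as vertices, two different vertices $(x,k),(y,l)$ being adjacent iff $\langle\psi_{xk}|\psi_{yl}\rangle\ne 0$. For each connected component $a$ of this graph put $P_a=\sum_{k:(x,k)\in a}|\psi_{xk}\rangle\langle\psi_{xk}|$ (independent of $x$) and $r_a=\operatorname{tr}P_a$, and let $r_{\min}=\min_a r_a$. A ZUS $\rho$ is a ZUS with least entanglement (ZUSLE) if $\rho=\sum_a (P_a\otimes 1)\rho(P_a\otimes 1)$ and $\operatorname{tr}[\rho(P_a\otimes 1)]=0$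 for all $a$ with $r_a>r_{\min}$. Let $|\Phi(r_{\min})\rangle=r_{\min}^{-1/2}\sum_{s=1}^{r_{\min}}|e_s\rangle\otimes|f_s\rangle$, with orthonormal families $(e_s)$ and $(f_s)$ in finite-dimensional Hilbert spaces of Alice and Bob, be any maximally entangled pure state of Schmidt rank $r_{\min}$. Then a ZUS $\rho$ on $\mathcal H_A\otimes\mathcal H_B$ with respect to $\mathscr B$ is a ZUSLE if and only if $\rho$ can be created from $|\Phi(r_{\min})\rangle\langle\Phi(r_{\min})|$ by LOCC, that is, by a protocol of finitely many rounds in each of which one party applies a local quantum instrument with finitely many outcomes (possibly changing the dimension of the local space) and announces the outcome, on which the later rounds may depend, all outcomes being forgotten at the end. -/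

import Mathlib

open scoped Matrix Kronecker ComplexOrder

namespace ZeroUncertainty

noncomputable section

/-! ### States and local operations -/

/-- Operators on the Hilbert space `ℂᵖ ⊗ ℂ^q`, as matrices in the computational basis. -/
abbrev BiOp (p q : ℕ) : Type := Matrix (Fin p × Fin q) (Fin p × Fin q) ℂ

/-- Density operators: positive semidefinite with unit trace. -/
def IsState {ι : Type*} [Fintype ι] (ρ : Matrix ι ι ℂ) : Prop :=
  ρ.PosSemidef ∧ ρ.trace = 1

/-- The operator `|v⟩⟨v|` of a vector `v`. -/
def ketbra {ι : Type*} (v : ι → ℂ) : Matrix ι ι ℂ := Matrix.vecMulVec v (star v)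

/-- The completely positive map `ρ ↦ M ρ M†` with the single Kraus operator `M`. -/
def krausMap {ι κ : Type*} [Fintype ι] (M : Matrix κ ι ℂ) :
    Matrix ι ι ℂ →ₗ[ℂ] Matrix κ κ ℂ where
  toFun ρ := M * ρ * Mᴴ
  map_add' ρ σ := by rw [Matrix.mul_add, Matrix.add_mul]
  map_smul' c ρ := by simp

/-- `IsLOCC p' q' p q Λ`: the linear map `Λ` from operators on `ℂᵖ ⊗ ℂ^q` to operators on
`ℂ^p' ⊗ ℂ^q'` is realized by local operations and (two-way) classical communication in finitely
many rounds. In each round one of the parties applies a local quantum instrument, whose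
Kraus operators `K k l` may change the dimension of the local space (local ancillas may be added or
discarded). The outcome `k` is announced to the other party and the rest of the protocol, `Λ k`,
may depend on it; the outcome `l` is not recorded. At the end all outcomes are forgotten. -/
inductive IsLOCC (p' q' : ℕ) : (p q : ℕ) → (BiOp p q →ₗ[ℂ] BiOp p' q') → Prop
  | done : IsLOCC p' q' p' q' LinearMap.id
  | alice {p q r n t : ℕ} (K : Fin n → Fin t → Matrix (Fin r) (Fin p) ℂ)
      (hK : ∑ k, ∑ l, (K k l)ᴴ * K k l = 1)
      (Λ : Fin n → (BiOp r q →ₗ[ℂ] BiOp p' q'))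
      (hΛ : ∀ k, IsLOCC p' q' r q (Λ k)) :
      IsLOCC p' q' p q
        (∑ k, Λ k ∘ₗ ∑ l, krausMap (K k l ⊗ₖ (1 : Matrix (Fin q) (Fin q) ℂ)))
  | bob {p q r n t : ℕ} (K : Fin n → Fin t → Matrix (Fin r) (Fin q) ℂ)
      (hK : ∑ k, ∑ l, (K k l)ᴴ * K k l = 1)
      (Λ : Fin n → (BiOp p r →ₗ[ℂ] BiOp p' q'))
      (hΛ : ∀ k, IsLOCC p' q' p r (Λ k)) :
      IsLOCC p' q' p q
        (∑ k, Λ k ∘ₗ ∑ l, krausMap ((1 : Matrix (Fin p) (Fin p) ℂ) ⊗ₖ K k l))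

/-- `σ` can be created from `ρ` by LOCC. -/
def CanCreate {p q p' q' : ℕ} (ρ : BiOp p q) (σ : BiOp p' q') : Prop :=
  ∃ Λ : BiOp p q →ₗ[ℂ] BiOp p' q', IsLOCC p' q' p q Λ ∧ Λ ρ = σ

/-- `Φ ∈ ℂᵖ ⊗ ℂ^q` is a maximally entangled pure state of Schmidt rank `r`:
`Φ = r^{-1/2} ∑ₛ eₛ ⊗ fₛ` with orthonormal families `(eₛ)` and `(fₛ)` of length `r`. -/
def IsMaxEntangled {p q : ℕ} (r : ℕ) (Φ : Fin p × Fin q → ℂ) : Prop :=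
  ∃ (e : Fin r → EuclideanSpace ℂ (Fin p)) (f : Fin r → EuclideanSpace ℂ (Fin q)),
    Orthonormal ℂ e ∧ Orthonormal ℂ f ∧
      ∀ i j, Φ (i, j) = ((Real.sqrt r : ℝ) : ℂ)⁻¹ * ∑ s, e s i * f s j

/-! ### Basis sets, zero-uncertainty states -/

/-- A family of `m` orthonormal bases of `ℂ^d`; the vectors of the basis `B x` are `B x k`. -/
abbrev BasisSet (m d : ℕ) : Type :=
  Fin m → OrthonormalBasis (Fin d) ℂ (EuclideanSpace ℂ (Fin d))

variable {m d : ℕ}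

/-- The projector `|ψ_{xk}⟩⟨ψ_{xk}|`. -/
def basisProj (B : BasisSet m d) (x : Fin m) (k : Fin d) : Matrix (Fin d) (Fin d) ℂ :=
  ketbra fun i => B x k i

/-- A POVM with outcomes `κ`. -/
def IsPOVM {κ ι : Type*} [Fintype κ] [Fintype ι] [DecidableEq ι] (E : κ → Matrix ι ι ℂ) : Prop :=
  (∀ k, (E k).PosSemidef) ∧ ∑ k, E k = 1

/-- A zero-uncertainty state: for each basis of Alice, Bob has a POVM that predicts her outcome
with probability one. -/
def IsZUS {n : ℕ} (B : BasisSet m d) (ρ : BiOp d n) : Prop :=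
  IsState ρ ∧ ∀ x, ∃ E : Fin d → Matrix (Fin n) (Fin n) ℂ,
    IsPOVM E ∧ ∑ k, (ρ * (basisProj B x k ⊗ₖ E k)).trace = 1

/-! ### Transition graph and its components -/

/-- The transition graph: the vertices are the (labelled) basis vectors; distinct vertices are
adjacent iff the vectors are not orthogonal. -/
def transitionGraph (B : BasisSet m d) : SimpleGraph (Fin m × Fin d) where
  Adj v w := v ≠ w ∧ inner ℂ (B v.1 v.2) (B w.1 w.2) ≠ 0
  symm := ⟨fun _ _ h => ⟨h.1.symm, fun h0 => h.2 (inner_eq_zero_symm.mp h0)⟩⟩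
  loopless := ⟨fun _ h => h.1 rfl⟩

/-- The irreducible components of a basis set. -/
abbrev Component (B : BasisSet m d) : Type := (transitionGraph B).ConnectedComponent

instance (B : BasisSet m d) : Fintype (Component B) := Fintype.ofFinite _

open Classical in
/-- The projector `∑_{ψ ∈ B_x^a} |ψ⟩⟨ψ|` computed in the basis `x`. -/
def componentProjAt (B : BasisSet m d) (x : Fin m) (a : Component B) :
    Matrix (Fin d) (Fin d) ℂ :=
  ∑ k with (transitionGraph B).connectedComponentMk (x, k) = a, basisProj B x k

/-- The component projector `P_a`; the choice of the basis is irrelevant, see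
`componentProj_eq`. -/
def componentProj [NeZero m] (B : BasisSet m d) (a : Component B) : Matrix (Fin d) (Fin d) ℂ :=
  componentProjAt B 0 a

open Classical in
/-- The component rank `r_a = tr P_a`, see `trace_componentProj`. -/
def componentRank [NeZero m] (B : BasisSet m d) (a : Component B) : ℕ :=
  Finset.card {k : Fin d | (transitionGraph B).connectedComponentMk (0, k) = a}

/-- The minimum component rank. -/
def minRank [NeZero m] (B : BasisSet m d) : ℕ := ⨅ a, componentRank B a

lemma basisProj_mulVec (B : BasisSet m d) (x y : Fin m) (k l : Fin d) :
    basisProj B x k *ᵥ (fun i => B y l i) =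
      inner ℂ (B x k) (B y l) • fun i => B x k i := by
  ext i
  simp only [basisProj, ketbra, Matrix.mulVec, dotProduct, Matrix.vecMulVec_apply, Pi.star_apply,
    PiLp.inner_apply, RCLike.inner_apply, Pi.smul_apply, smul_eq_mul, Finset.sum_mul]
  refine Finset.sum_congr rfl fun j _ => ?_
  simp only [starRingEnd_apply]
  ring

lemma inner_eq_zero_of_component_ne (B : BasisSet m d) {x y : Fin m} {k l : Fin d}
    (h : (transitionGraph B).connectedComponentMk (x, k) ≠
      (transitionGraph B).connectedComponentMk (y, l)) :
    inner ℂ (B x k) (B y l) = 0 := by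
  by_contra h0
  refine h (SimpleGraph.ConnectedComponent.sound (SimpleGraph.Adj.reachable ⟨?_, h0⟩))
  rintro h1
  exact h (congrArg _ h1)

open Classical in
lemma componentProjAt_mulVec (B : BasisSet m d) (x y : Fin m) (a : Component B) (l : Fin d) :
    componentProjAt B x a *ᵥ (fun i => B y l i) =
      if (transitionGraph B).connectedComponentMk (y, l) = a then (fun i => B y l i) else 0 := by
  have hsum : ∑ k, inner ℂ (B x k) (B y l) • (fun i => B x k i) = fun i => B y l i := by
    ext i
    have := congrArg (fun v : EuclideanSpace ℂ (Fin d) => v i) ((B x).sum_repr' (B y l))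
    simpa [Finset.sum_apply] using this
  rw [componentProjAt, Matrix.sum_mulVec]
  simp only [basisProj_mulVec]
  split_ifs with h
  · rw [← hsum, Finset.sum_filter]
    refine Finset.sum_congr rfl fun k _ => ?_
    split_ifs with hk
    · rfl
    · rw [inner_eq_zero_of_component_ne B (fun h' => hk (h'.trans h)), zero_smul]
  · refine Finset.sum_eq_zero fun k hk => ?_
    rw [inner_eq_zero_of_component_ne B, zero_smul]
    rw [(Finset.mem_filter.mp hk).2]
    exact fun h' => h h'.symm

/-- The component projector can be computed in any basis of the basis set. -/
theorem componentProj_eq [NeZero m] (B : BasisSet m d) (x : Fin m) (a : Component B) :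
    componentProj B a = componentProjAt B x a := by
  have h : (componentProj B a).toLin' ∘ₗ (WithLp.linearEquiv 2 ℂ (Fin d → ℂ)).toLinearMap =
      (componentProjAt B x a).toLin' ∘ₗ (WithLp.linearEquiv 2 ℂ (Fin d → ℂ)).toLinearMap := by
    refine (B 0).toBasis.ext fun l => ?_
    have h1 := componentProjAt_mulVec B 0 0 a l
    have h2 := componentProjAt_mulVec B x 0 a l
    simpa [componentProj] using h1.trans h2.symm
  have h' := (LinearMap.cancel_right (LinearEquiv.surjective _)).mp h
  exact Matrix.toLin'.injective h'

theorem trace_componentProj [NeZero m] (B : BasisSet m d) (a : Component B) :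
    (componentProj B a).trace = componentRank B a := by
  have h : ∀ k, (basisProj B 0 k).trace = 1 := fun k => by
    have h1 := (B 0).orthonormal.1 k
    have h2 := inner_self_eq_norm_sq_to_K (𝕜 := ℂ) (B 0 k)
    rw [h1, PiLp.inner_apply] at h2
    simp only [RCLike.inner_apply] at h2
    simp only [basisProj, ketbra, Matrix.trace, Matrix.diag_apply, Matrix.vecMulVec_apply,
      Pi.star_apply]
    simpa using h2
  simp [componentProj, componentProjAt, componentRank, Matrix.trace_sum, h]

/-! ### Zero-uncertainty states with least entanglement -/

/-- The map `Λ_B` that removes the coherence between different component subspaces: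
`ρ ↦ ∑ₐ (Pₐ ⊗ 1) ρ (Pₐ ⊗ 1)`. -/
def dephase [NeZero m] {n : ℕ} (B : BasisSet m d) (ρ : BiOp d n) : BiOp d n :=
  ∑ a, (componentProj B a ⊗ₖ (1 : Matrix (Fin n) (Fin n) ℂ)) * ρ *
    (componentProj B a ⊗ₖ (1 : Matrix (Fin n) (Fin n) ℂ))

/-- The entry `q_a = tr[ρ (P_a ⊗ 1)]` of the component vector. -/
def componentWeight [NeZero m] {n : ℕ} (B : BasisSet m d) (ρ : BiOp d n) (a : Component B) : ℂ :=
  (ρ * (componentProj B a ⊗ₖ (1 : Matrix (Fin n) (Fin n) ℂ))).trace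

/-- A zero-uncertainty state with least entanglement: it is economical (`ρ = Λ_B(ρ)`), and
`q_a = 0` whenever `r_a > r_min`. -/
def IsZUSLE [NeZero m] {n : ℕ} (B : BasisSet m d) (ρ : BiOp d n) : Prop :=
  IsZUS B ρ ∧ ρ = dephase B ρ ∧
    ∀ a, minRank B < componentRank B a → componentWeight B ρ a = 0

end

end ZeroUncertainty

/-! Describe a pure state by its coefficient matrix `M`: its Schmidt rank is the rank of `M`, and
Alice's unnormalised reduced operator is `M * Mᴴ`. The key fact concerns every pure term of every
decomposition of a ZUS: its reduced operator acts as a scalar `c a` on the range of each `P_a`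
(`IsZUS.exists_mulVec_eq_smul`). Perfect prediction makes this operator diagonal in every basis, and
eigenvectors of a Hermitian operator that are not orthogonal share their eigenvalue.

The Schmidt rank of such a term is therefore the sum of the `r_a` with `c a ≠ 0`. If it is at most
`r_min`, a nonzero term lives in one component, of rank `r_min` (`exists_componentProj_mul_eq`).
Local operations replace `M` by `A * M * Cᵀ`, which does not raise the rank. Hence a ZUS created
from `Φ(r_min)` is a mixture of such terms, so it is a ZUSLE.

Conversely, the blocks `N = P_a * M` of a ZUSLE satisfy `N * Nᴴ = c a • P_a`, so each is zero or
proportional to a maximally entangled vector of rank `r_a`, and only blocks with `r_a = r_min`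
survive (`IsZUSLE.mem_maxEntangledCone`). To create the mixture, Alice draws a term at random,
applies its isometry and announces the result; Bob then applies his isometry
(`canCreate_of_mem_maxEntangledCone`). -/

namespace ZeroUncertainty

section

/-! ### Vectorisation and product Kraus operators -/

/-- The vector of `ℂᵖ ⊗ ℂ^q` with coefficient matrix `M`. -/
def tensorVec {p q : ℕ} (M : Matrix (Fin p) (Fin q) ℂ) : Fin p × Fin q → ℂ :=
  fun x => M x.1 x.2

lemma tensorVec_eq_vec {p q : ℕ} (M : Matrix (Fin p) (Fin q) ℂ) : tensorVec M = Mᵀ.vec := rfl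

@[simp]
lemma tensorVec_zero {p q : ℕ} : tensorVec (0 : Matrix (Fin p) (Fin q) ℂ) = 0 := rfl

/-- Reduces all local operations to matrix products, so that rank inequalities bound the Schmidt
rank. -/
lemma kronecker_mulVec_tensorVec {p q p' q' : ℕ} (A : Matrix (Fin p') (Fin p) ℂ)
    (C : Matrix (Fin q') (Fin q) ℂ) (M : Matrix (Fin p) (Fin q) ℂ) :
    (A ⊗ₖ C) *ᵥ tensorVec M = tensorVec (A * M * Cᵀ) := by
  have h := Matrix.kronecker_mulVec_vec C Mᵀ A
  rw [tensorVec_eq_vec, tensorVec_eq_vec, Matrix.transpose_mul, Matrix.transpose_mul,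
    Matrix.transpose_transpose, ← Matrix.mul_assoc]
  exact h

lemma mul_ketbra_mul_conjTranspose {ι κ : Type*} [Fintype ι] (A : Matrix κ ι ℂ) (v : ι → ℂ) :
    A * ketbra v * Aᴴ = ketbra (A *ᵥ v) := by
  rw [ketbra, ketbra, Matrix.mul_vecMulVec, Matrix.vecMulVec_mul, Matrix.star_mulVec]

lemma krausMap_ketbra {ι κ : Type*} [Fintype ι] (A : Matrix κ ι ℂ) (v : ι → ℂ) :
    krausMap A (ketbra v) = ketbra (A *ᵥ v) :=
  mul_ketbra_mul_conjTranspose A v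

@[simp]
lemma ketbra_zero {ι : Type*} : ketbra (0 : ι → ℂ) = 0 := by
  simp [ketbra]

lemma ketbra_smul {ι : Type*} (c : ℂ) (v : ι → ℂ) : ketbra (c • v) = (c * star c) • ketbra v := by
  ext i j
  simp only [ketbra, Matrix.vecMulVec_apply, Pi.smul_apply, Pi.star_apply, smul_eq_mul, star_mul,
    Matrix.smul_apply]
  ring

lemma trace_ketbra_mul {ι : Type*} [Fintype ι] (v : ι → ℂ) (A : Matrix ι ι ℂ) :
    (ketbra v * A).trace = star v ⬝ᵥ A *ᵥ v := by
  rw [ketbra, Matrix.vecMulVec_mul, Matrix.trace_vecMulVec, dotProduct_comm,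
    ← Matrix.dotProduct_mulVec]

lemma ketbra_mulVec {ι : Type*} [Fintype ι] (v w : ι → ℂ) :
    ketbra v *ᵥ w = (star v ⬝ᵥ w) • v := by
  rw [ketbra, Matrix.vecMulVec_mulVec, op_smul_eq_smul]

lemma conjTranspose_ketbra {ι : Type*} (v : ι → ℂ) : (ketbra v)ᴴ = ketbra v := by
  ext i j
  simp [ketbra, Matrix.vecMulVec_apply, mul_comm]

lemma trace_ketbra_tensorVec {p q : ℕ} (M : Matrix (Fin p) (Fin q) ℂ) :
    (ketbra (tensorVec M)).trace = (M * Mᴴ).trace := by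
  rw [ketbra, Matrix.trace_vecMulVec]
  simp [dotProduct, tensorVec, Matrix.trace, Matrix.mul_apply, Fintype.sum_prod_type]

/-- The joint probability of the outcome `w` for Alice and the effect `E` for Bob in the state
with coefficient matrix `M`. -/
lemma trace_ketbra_mul_kronecker {p q : ℕ} (M : Matrix (Fin p) (Fin q) ℂ) (w : Fin p → ℂ)
    (E : Matrix (Fin q) (Fin q) ℂ) :
    (ketbra (tensorVec M) * (ketbra w ⊗ₖ E)).trace =
      star (star w ᵥ* M) ⬝ᵥ E *ᵥ (star w ᵥ* M) := by
  rw [trace_ketbra_mul, kronecker_mulVec_tensorVec, tensorVec_eq_vec, tensorVec_eq_vec,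
    Matrix.star_vec_dotProduct_vec, Matrix.transpose_mul, Matrix.transpose_transpose,
    Matrix.transpose_mul, Matrix.trace_mul_comm, ketbra, Matrix.transpose_vecMulVec,
    Matrix.mul_vecMulVec, Matrix.mul_vecMulVec, Matrix.vecMulVec_mul, Matrix.trace_vecMulVec,
    Matrix.mulVec_transpose, dotProduct_comm, Matrix.star_vecMul, star_star]
  congr 1
  ext i
  simp [Matrix.vecMul, Matrix.mulVec, dotProduct, mul_comm]

/-- A positive semidefinite matrix on `ℂᵖ ⊗ ℂ^q` is a sum of pure states. -/
lemma exists_eq_sum_ketbra {p q : ℕ} {ρ : BiOp p q} (h : ρ.PosSemidef) :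
    ∃ M : Fin p × Fin q → Matrix (Fin p) (Fin q) ℂ, ρ = ∑ i, ketbra (tensorVec (M i)) := by
  open scoped MatrixOrder in
  obtain ⟨C, rfl⟩ := CStarAlgebra.nonneg_iff_eq_star_mul_self.mp h.nonneg
  refine ⟨fun i => Matrix.of fun a b => star (C i (a, b)), ?_⟩
  ext x y
  simp [Matrix.sum_apply, Matrix.mul_apply, ketbra, Matrix.vecMulVec_apply, tensorVec]

/-! ### The basis vectors -/

variable {m d : ℕ}

/-- The coordinates of the basis vector `B x k`. -/
noncomputable def basisVec (B : BasisSet m d) (x : Fin m) (k : Fin d) : Fin d → ℂ := fun i => B x k i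

lemma star_basisVec_dotProduct (B : BasisSet m d) (x y : Fin m) (k l : Fin d) :
    star (basisVec B x k) ⬝ᵥ basisVec B y l = inner ℂ (B x k) (B y l) := by
  simp [dotProduct, basisVec, PiLp.inner_apply, mul_comm]

lemma star_basisVec_dotProduct_self (B : BasisSet m d) (x : Fin m) (k l : Fin d) :
    star (basisVec B x k) ⬝ᵥ basisVec B x l = if k = l then 1 else 0 := by
  rw [star_basisVec_dotProduct, orthonormal_iff_ite.mp (B x).orthonormal]

lemma basisVec_ne_zero (B : BasisSet m d) (x : Fin m) (k : Fin d) : basisVec B x k ≠ 0 := by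
  intro h
  simpa [h] using star_basisVec_dotProduct_self B x k k

lemma ext_basisVec {ι : Type*} (B : BasisSet m d) (x : Fin m) {A C : Matrix ι (Fin d) ℂ}
    (h : ∀ k, A *ᵥ basisVec B x k = C *ᵥ basisVec B x k) : A = C := by
  have h' : A.toLin' ∘ₗ (WithLp.linearEquiv 2 ℂ (Fin d → ℂ)).toLinearMap =
      C.toLin' ∘ₗ (WithLp.linearEquiv 2 ℂ (Fin d → ℂ)).toLinearMap := by
    refine (B x).toBasis.ext fun l => ?_
    simpa using show A *ᵥ (B x l).ofLp = C *ᵥ (B x l).ofLp from h l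
  exact Matrix.toLin'.injective ((LinearMap.cancel_right (LinearEquiv.surjective _)).mp h')

lemma sum_basisProj (B : BasisSet m d) (x : Fin m) : ∑ k, basisProj B x k = 1 := by
  refine ext_basisVec B x fun l => ?_
  rw [Matrix.sum_mulVec, Matrix.one_mulVec]
  have h : ∀ k, basisProj B x k *ᵥ basisVec B x l =
      if k = l then basisVec B x l else 0 := fun k => by
    have := ketbra_mulVec (basisVec B x k) (basisVec B x l)
    rw [star_basisVec_dotProduct_self] at this
    refine this.trans ?_
    split_ifs with hk
    · rw [hk, one_smul]
    · rw [zero_smul]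
  simp [h]

lemma sum_dotProduct_smul_basisVec (B : BasisSet m d) (x : Fin m) (v : Fin d → ℂ) :
    ∑ k, (star (basisVec B x k) ⬝ᵥ v) • basisVec B x k = v := by
  conv_rhs => rw [← Matrix.one_mulVec v, ← sum_basisProj B x, Matrix.sum_mulVec]
  exact Finset.sum_congr rfl fun k _ => (ketbra_mulVec _ _).symm

lemma linearIndependent_basisVec (B : BasisSet m d) (x : Fin m) :
    LinearIndependent ℂ (basisVec B x) := by
  have h := (B x).orthonormal.linearIndependent.map'
    (WithLp.linearEquiv 2 ℂ (Fin d → ℂ)).toLinearMap (LinearEquiv.ker _)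
  exact h

/-! ### The component projectors -/

variable [NeZero m]

open Classical in
lemma componentProj_mulVec (B : BasisSet m d) (y : Fin m) (a : Component B) (l : Fin d) :
    componentProj B a *ᵥ basisVec B y l =
      if (transitionGraph B).connectedComponentMk (y, l) = a then basisVec B y l else 0 :=
  componentProjAt_mulVec B 0 y a l

lemma conjTranspose_componentProj (B : BasisSet m d) (a : Component B) :
    (componentProj B a)ᴴ = componentProj B a := by
  simp [componentProj, componentProjAt, Matrix.conjTranspose_sum, basisProj, conjTranspose_ketbra]

lemma componentProj_mul_self (B : BasisSet m d) (a : Component B) :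
    componentProj B a * componentProj B a = componentProj B a := by
  refine ext_basisVec B 0 fun l => ?_
  rw [← Matrix.mulVec_mulVec, componentProj_mulVec]
  split_ifs with h
  · rw [componentProj_mulVec, if_pos h]
  · simp

lemma sum_componentProj (B : BasisSet m d) : ∑ a, componentProj B a = 1 := by
  classical
  refine ext_basisVec B 0 fun l => ?_
  simp [Matrix.sum_mulVec, componentProj_mulVec]

/-- The rank counts vertices of basis `0` only, and a component is given by a vertex of some basis.
If basis `0` missed it, `P_a` would vanish, yet `P_a` fixes the vector of that vertex. -/
lemma componentRank_pos (B : BasisSet m d) (a : Component B) : 0 < componentRank B a := by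
  rw [Nat.pos_iff_ne_zero]
  intro h
  have h0 : componentProj B a = 0 := by
    rw [componentRank, Finset.card_eq_zero] at h
    rw [componentProj, componentProjAt, h, Finset.sum_empty]
  induction a using SimpleGraph.ConnectedComponent.ind with
  | h v =>
    have h1 := componentProj_mulVec B v.1 ((transitionGraph B).connectedComponentMk v) v.2
    rw [h0, if_pos rfl, Matrix.zero_mulVec] at h1
    exact basisVec_ne_zero B _ _ h1.symm

lemma minRank_le (B : BasisSet m d) (a : Component B) : minRank B ≤ componentRank B a :=
  ciInf_le (OrderBot.bddBelow _) a

lemma exists_componentRank_eq_minRank (B : BasisSet m d) [Nonempty (Component B)] :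
    ∃ a, componentRank B a = minRank B :=
  ciInf_mem _

/-- An isometry onto the range of the component projector. -/
lemma exists_isometry_componentProj (B : BasisSet m d) (a : Component B) :
    ∃ V : Matrix (Fin d) (Fin (componentRank B a)) ℂ, Vᴴ * V = 1 ∧ V * Vᴴ = componentProj B a := by
  classical
  let s : Finset (Fin d) := {k : Fin d | (transitionGraph B).connectedComponentMk (0, k) = a}
  have hs : s.card = componentRank B a := by simp [s, componentRank]
  let e := s.orderIsoOfFin hs
  refine ⟨Matrix.of fun i j => basisVec B 0 (e j) i, ?_, ?_⟩
  · ext i j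
    have h := star_basisVec_dotProduct_self B 0 (e i) (e j)
    simp only [Subtype.coe_inj, e.injective.eq_iff] at h
    simpa [Matrix.mul_apply, Matrix.one_apply, dotProduct] using h
  · have h : componentProj B a = ∑ j, ketbra (basisVec B 0 (e j)) := by
      rw [show ∑ j, ketbra (basisVec B 0 (e j)) = _ from
          e.toEquiv.sum_comp (fun k : s => ketbra (basisVec B 0 k)),
        Finset.sum_coe_sort s (fun k => ketbra (basisVec B 0 k)), componentProj, componentProjAt]
      refine Finset.sum_congr ?_ fun _ _ => rfl
      ext k
      simp [s]
    rw [h]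
    ext i j
    simp [Matrix.mul_apply, Matrix.sum_apply, ketbra, Matrix.vecMulVec_apply]

end

section

/-! ### The structure of zero-uncertainty states -/

variable {m d n : ℕ} {ι : Type*} [Fintype ι]

/-- The joint probabilities of all outcome pairs are nonnegative and sum to `1`, which the equal
pairs already exhaust. So each unequal pair has probability zero, as does each pure term's
contribution to it, and a positive semidefinite effect with vanishing expectation annihilates the
vector. -/
lemma IsZUS.mulVec_eq_zero {B : BasisSet m d} {M : ι → Matrix (Fin d) (Fin n) ℂ}
    (h : IsState (∑ i, ketbra (tensorVec (M i)))) {x : Fin m} {E : Fin d → Matrix (Fin n) (Fin n) ℂ}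
    (hE : IsPOVM E)
    (h1 : ∑ k, ((∑ i, ketbra (tensorVec (M i))) * (basisProj B x k ⊗ₖ E k)).trace = 1)
    (i : ι) {k l : Fin d} (hkl : k ≠ l) : E l *ᵥ (star (basisVec B x k) ᵥ* M i) = 0 := by
  classical
  set ρ := ∑ i, ketbra (tensorVec (M i)) with hρ
  have hterm : ∀ k l, (ρ * (basisProj B x k ⊗ₖ E l)).trace =
      ∑ i, star (star (basisVec B x k) ᵥ* M i) ⬝ᵥ E l *ᵥ (star (basisVec B x k) ᵥ* M i) := by
    intro k l
    rw [hρ, Finset.sum_mul, Matrix.trace_sum]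
    exact Finset.sum_congr rfl fun i _ => trace_ketbra_mul_kronecker (M i) (basisVec B x k) (E l)
  have hnn : ∀ k l i,
      0 ≤ star (star (basisVec B x k) ᵥ* M i) ⬝ᵥ E l *ᵥ (star (basisVec B x k) ᵥ* M i) :=
    fun k l i => (hE.1 l).dotProduct_mulVec_nonneg _
  have hnn' : ∀ k l, 0 ≤ (ρ * (basisProj B x k ⊗ₖ E l)).trace := fun k l => by
    rw [hterm]
    exact Finset.sum_nonneg fun i _ => hnn k l i
  have hone : ∑ k, ∑ l, basisProj B x k ⊗ₖ E l = 1 := by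
    rw [← Matrix.one_kronecker_one, ← sum_basisProj B x, ← hE.2]
    ext a b
    simp [Matrix.sum_apply, Matrix.kroneckerMap_apply, Finset.sum_mul_sum]
  have htot : ∑ k, ∑ l, (ρ * (basisProj B x k ⊗ₖ E l)).trace = 1 := by
    simp only [← Matrix.trace_sum, ← Finset.mul_sum, hone, mul_one, h.2]
  have hdiff : ∑ k, ∑ l ∈ Finset.univ.erase k, (ρ * (basisProj B x k ⊗ₖ E l)).trace = 0 := by
    have h2 : ∀ k, ∑ l, (ρ * (basisProj B x k ⊗ₖ E l)).trace =
        (ρ * (basisProj B x k ⊗ₖ E k)).trace +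
          ∑ l ∈ Finset.univ.erase k, (ρ * (basisProj B x k ⊗ₖ E l)).trace :=
      fun k => (Finset.add_sum_erase _ _ (Finset.mem_univ k)).symm
    simp only [h2, Finset.sum_add_distrib, h1] at htot
    simpa using htot
  have h3 := (Finset.sum_eq_zero_iff_of_nonneg fun k _ =>
    Finset.sum_nonneg fun l _ => hnn' k l).mp hdiff k (Finset.mem_univ k)
  have h4 := (Finset.sum_eq_zero_iff_of_nonneg fun l _ => hnn' k l).mp h3 l
    (Finset.mem_erase.mpr ⟨hkl.symm, Finset.mem_univ l⟩)
  rw [hterm] at h4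
  have h5 := (Finset.sum_eq_zero_iff_of_nonneg fun i _ => hnn k l i).mp h4 i (Finset.mem_univ i)
  exact ((hE.1 l).dotProduct_mulVec_zero_iff _).mp h5

/-- Each pure component of a zero-uncertainty state has a reduced operator that is diagonal in all
bases. -/
lemma IsZUS.dotProduct_mulVec_eq_zero {B : BasisSet m d} {M : ι → Matrix (Fin d) (Fin n) ℂ}
    (h : IsZUS B (∑ i, ketbra (tensorVec (M i)))) (i : ι) (x : Fin m) {k l : Fin d} (hkl : k ≠ l) :
    star (basisVec B x k) ⬝ᵥ (M i * (M i)ᴴ) *ᵥ basisVec B x l = 0 := by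
  obtain ⟨E, hE, h1⟩ := h.2 x
  have h0 := fun {k l : Fin d} (hkl : k ≠ l) => IsZUS.mulVec_eq_zero h.1 hE h1 i hkl
  set u := fun k => star (basisVec B x k) ᵥ* M i with hu
  have h2 : star (u l) ⬝ᵥ u k = 0 := by
    -- Insert `1 = ∑ j, E j`: the effect `E j` kills `u l` when `j = k`, and `u k` otherwise.
    have h3 : ∑ j, star (u l) ⬝ᵥ E j *ᵥ u k = star (u l) ⬝ᵥ u k := by
      rw [← dotProduct_sum, ← Matrix.sum_mulVec, hE.2, Matrix.one_mulVec]
    rw [← h3]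
    refine Finset.sum_eq_zero fun j _ => ?_
    by_cases hj : k = j
    · have h4 : E j *ᵥ u l = 0 := h0 (hj ▸ hkl.symm)
      rw [Matrix.dotProduct_mulVec, ← (hE.1 j).1.eq, ← Matrix.star_mulVec, h4, star_zero,
        zero_dotProduct]
    · rw [show E j *ᵥ u k = 0 from h0 hj, dotProduct_zero]
  rw [← h2, hu, ← Matrix.mulVec_mulVec, Matrix.dotProduct_mulVec, dotProduct_comm]
  simp [Matrix.star_vecMul]

/-- The reduced operator of each pure component of a zero-uncertainty state is constant on the
irreducible components. -/
theorem IsZUS.exists_mulVec_eq_smul {B : BasisSet m d} {M : ι → Matrix (Fin d) (Fin n) ℂ}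
    (h : IsZUS B (∑ i, ketbra (tensorVec (M i)))) (i : ι) :
    ∃ c : Component B → ℂ, ∀ x k, (M i * (M i)ᴴ) *ᵥ basisVec B x k =
      c ((transitionGraph B).connectedComponentMk (x, k)) • basisVec B x k := by
  classical
  set T := M i * (M i)ᴴ with hT
  have hTH : Tᴴ = T := by simp [hT]
  let t : Fin m × Fin d → ℂ := fun v => star (basisVec B v.1 v.2) ⬝ᵥ T *ᵥ basisVec B v.1 v.2
  have heig : ∀ x k, T *ᵥ basisVec B x k = t (x, k) • basisVec B x k := by
    intro x k
    rw [← sum_dotProduct_smul_basisVec B x (T *ᵥ basisVec B x k), Finset.sum_eq_single k]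
    · intro l _ hl
      rw [h.dotProduct_mulVec_eq_zero i x hl, zero_smul]
    · simp
  have hreal : ∀ v, star (t v) = t v := by
    intro v
    simp only [t]
    rw [← Matrix.star_dotProduct_star, star_star, Matrix.star_mulVec, hTH, Matrix.dotProduct_mulVec]
  -- Let the Hermitian `T` act to the right or to the left in the same matrix element, then cancel
  -- the nonzero overlap.
  have hadj : ∀ v w, (transitionGraph B).Adj v w → t v = t w := by
    rintro ⟨x, k⟩ ⟨y, l⟩ ⟨-, hne⟩
    have h1 : star (basisVec B x k) ⬝ᵥ T *ᵥ basisVec B y l =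
        t (y, l) * (star (basisVec B x k) ⬝ᵥ basisVec B y l) := by
      rw [heig, dotProduct_smul, smul_eq_mul]
    have h2 : star (basisVec B x k) ⬝ᵥ T *ᵥ basisVec B y l =
        t (x, k) * (star (basisVec B x k) ⬝ᵥ basisVec B y l) := by
      rw [Matrix.dotProduct_mulVec, ← hTH, ← Matrix.star_mulVec, heig, star_smul, hreal,
        smul_dotProduct, smul_eq_mul]
    rw [star_basisVec_dotProduct] at h1 h2
    exact mul_right_cancel₀ hne (h2.symm.trans h1)
  have hreach : ∀ v w, (transitionGraph B).Reachable v w → t v = t w := by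
    rintro v w ⟨p⟩
    induction p with
    | nil => rfl
    | cons hvw _ ih => exact (hadj _ _ hvw).trans ih
  refine ⟨fun a => t a.out, fun x k => ?_⟩
  rw [heig]
  congr 1
  exact hreach _ _ (SimpleGraph.ConnectedComponent.exact (Quot.out_eq _).symm)

lemma componentProj_mul_eq_smul [NeZero m] {B : BasisSet m d} {T : Matrix (Fin d) (Fin d) ℂ}
    {c : Component B → ℂ} (h : ∀ x k, T *ᵥ basisVec B x k =
      c ((transitionGraph B).connectedComponentMk (x, k)) • basisVec B x k) (a : Component B) :
    componentProj B a * T = c a • componentProj B a := by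
  refine ext_basisVec B 0 fun k => ?_
  rw [← Matrix.mulVec_mulVec, h, Matrix.mulVec_smul, Matrix.smul_mulVec, componentProj_mulVec]
  split_ifs with hk
  · rw [hk]
  · simp

open Classical in
-- Eigenvectors with nonzero eigenvalue lie in the range of `T`, and those counted are linearly
-- independent.
lemma card_eigenvalue_ne_zero_le_rank [NeZero m] {B : BasisSet m d} {T : Matrix (Fin d) (Fin d) ℂ}
    {t : Fin d → ℂ} (h : ∀ k, T *ᵥ basisVec B 0 k = t k • basisVec B 0 k) :
    Finset.card {k | t k ≠ 0} ≤ T.rank := by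
  have hli : LinearIndependent ℂ fun k : {k // t k ≠ 0} => basisVec B 0 k :=
    (linearIndependent_basisVec B 0).comp _ Subtype.val_injective
  have hmem : ∀ k : {k // t k ≠ 0}, basisVec B 0 k ∈ LinearMap.range T.mulVecLin := fun k =>
    ⟨(t k)⁻¹ • basisVec B 0 k, by
      rw [Matrix.mulVecLin_apply, Matrix.mulVec_smul, h, smul_smul, inv_mul_cancel₀ k.2, one_smul]⟩
  have hli' : LinearIndependent ℂ fun k : {k // t k ≠ 0} =>
      (⟨basisVec B 0 k, hmem k⟩ : LinearMap.range T.mulVecLin) :=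
    LinearIndependent.of_comp (LinearMap.range T.mulVecLin).subtype hli
  have := hli'.fintype_card_le_finrank
  rwa [Fintype.card_subtype] at this

/-- A pure component of a zero-uncertainty state whose Schmidt rank is at most the minimum
component rank lives in a single component of minimum rank. -/
theorem exists_componentProj_mul_eq [NeZero m] {B : BasisSet m d} {M : Matrix (Fin d) (Fin n) ℂ}
    {c : Component B → ℂ} (h : ∀ x k, (M * Mᴴ) *ᵥ basisVec B x k =
      c ((transitionGraph B).connectedComponentMk (x, k)) • basisVec B x k)
    (hr : M.rank ≤ minRank B) (hM : M ≠ 0) :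
    ∃ a, componentRank B a = minRank B ∧ componentProj B a * M = M ∧
      ∀ b, b ≠ a → componentProj B b * M = 0 := by
  classical
  have hcard := card_eigenvalue_ne_zero_le_rank (h 0)
  rw [Matrix.rank_self_mul_conjTranspose] at hcard
  have hzero : ∀ b, c b = 0 → componentProj B b * M = 0 := fun b hb => by
    have := componentProj_mul_eq_smul h b
    rwa [hb, zero_smul, Matrix.mul_self_mul_conjTranspose_eq_zero] at this
  obtain ⟨a, ha⟩ : ∃ a, c a ≠ 0 := by
    by_contra! hc
    refine hM ?_
    rw [← Matrix.one_mul M, ← sum_componentProj B, Matrix.sum_mul]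
    exact Finset.sum_eq_zero fun b _ => hzero b (hc b)
  have hdisj : ∀ b, b ≠ a → c b = 0 := by
    intro b hb
    by_contra hcb
    -- Two components with nonzero eigenvalue would force rank at least `r_a + r_b`, which exceeds
    -- `r_min`.
    have hsub : ({k | (transitionGraph B).connectedComponentMk (0, k) = a} : Finset (Fin d)) ∪
        ({k | (transitionGraph B).connectedComponentMk (0, k) = b} : Finset (Fin d)) ⊆
        ({k | c ((transitionGraph B).connectedComponentMk (0, k)) ≠ 0} : Finset (Fin d)) := by
      intro k hk
      simp only [Finset.mem_union, Finset.mem_filter, Finset.mem_univ, true_and] at hk ⊢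
      rcases hk with hk | hk <;> rwa [hk]
    have h1 := Finset.card_le_card hsub
    rw [Finset.card_union_of_disjoint] at h1
    · have h2 : componentRank B a + componentRank B b ≤ _ := h1
      have h3 := minRank_le B a
      have h4 := componentRank_pos B b
      omega
    · rw [Finset.disjoint_filter]
      rintro k - hka hkb
      exact hb (hkb.symm.trans hka)
  refine ⟨a, le_antisymm ?_ (minRank_le B a), ?_, fun b hb => hzero b (hdisj b hb)⟩
  · refine le_trans ?_ (hcard.trans hr)
    refine Finset.card_le_card fun k hk => ?_
    simp only [Finset.mem_filter, Finset.mem_univ, true_and] at hk ⊢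
    rwa [hk]
  · conv_rhs => rw [← Matrix.one_mul M, ← sum_componentProj B, Matrix.sum_mul]
    rw [Finset.sum_eq_single a (fun b _ hb => hzero b (hdisj b hb)) (by simp)]

end

section

/-! ### Local operations do not increase the Schmidt number -/

/-- The cone of (unnormalised) states of Schmidt number at most `r`. -/
def schmidtCone (p q r : ℕ) : AddSubmonoid (BiOp p q) :=
  AddSubmonoid.closure {σ | ∃ M : Matrix (Fin p) (Fin q) ℂ, M.rank ≤ r ∧ σ = ketbra (tensorVec M)}

lemma krausMap_mem_schmidtCone {p q p' q' r : ℕ} (A : Matrix (Fin p') (Fin p) ℂ)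
    (C : Matrix (Fin q') (Fin q) ℂ) {σ : BiOp p q} (hσ : σ ∈ schmidtCone p q r) :
    krausMap (A ⊗ₖ C) σ ∈ schmidtCone p' q' r := by
  refine AddSubmonoid.closure_induction (motive := fun σ _ => krausMap (A ⊗ₖ C) σ ∈
    schmidtCone p' q' r) ?_ ?_ ?_ hσ
  · rintro _ ⟨M, hM, rfl⟩
    rw [krausMap_ketbra, kronecker_mulVec_tensorVec]
    exact AddSubmonoid.subset_closure ⟨_, ((Matrix.rank_mul_le_left _ _).trans
      (Matrix.rank_mul_le_right _ _)).trans hM, rfl⟩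
  · rw [map_zero]
    exact zero_mem _
  · intro σ τ _ _ hσ hτ
    rw [map_add]
    exact add_mem hσ hτ

/-- Each Kraus operator of a round is a product operator, and forgetting outcomes only adds terms,
under which the cone is closed. -/
lemma IsLOCC.map_mem_schmidtCone {p' q' p q r : ℕ} {Λ : BiOp p q →ₗ[ℂ] BiOp p' q'}
    (h : IsLOCC p' q' p q Λ) {σ : BiOp p q} (hσ : σ ∈ schmidtCone p q r) :
    Λ σ ∈ schmidtCone p' q' r := by
  induction h with
  | done => exact hσ
  | alice K hK Λ hΛ ih =>
    simp only [LinearMap.sum_apply, LinearMap.comp_apply]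
    exact sum_mem fun k _ => ih k (sum_mem fun l _ => krausMap_mem_schmidtCone _ _ hσ)
  | bob K hK Λ hΛ ih =>
    simp only [LinearMap.sum_apply, LinearMap.comp_apply]
    exact sum_mem fun k _ => ih k (sum_mem fun l _ => krausMap_mem_schmidtCone _ _ hσ)

/-- Every element of an additive closure is a finite sum of generators. -/
lemma exists_sum_eq_of_mem_closure {α : Type*} [AddCommMonoid α] {s : Set α} {x : α}
    (h : x ∈ AddSubmonoid.closure s) : ∃ (N : ℕ) (f : Fin N → α), (∀ i, f i ∈ s) ∧ x = ∑ i, f i := by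
  obtain ⟨l, hl, rfl⟩ := AddSubmonoid.exists_list_of_mem_closure h
  exact ⟨l.length, l.get, fun i => hl _ (l.get_mem i), by
    rw [← List.sum_ofFn, List.ofFn_get]⟩

/-- The coefficient matrix of a maximally entangled state. -/
lemma IsMaxEntangled.exists_isometries {p q r : ℕ} {Φ : Fin p × Fin q → ℂ}
    (h : IsMaxEntangled r Φ) :
    ∃ (X : Matrix (Fin p) (Fin r) ℂ) (Y : Matrix (Fin q) (Fin r) ℂ), Xᴴ * X = 1 ∧ Yᴴ * Y = 1 ∧
      Φ = tensorVec (X * (((Real.sqrt r : ℝ) : ℂ)⁻¹ • (1 : Matrix (Fin r) (Fin r) ℂ)) * Yᵀ) := by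
  obtain ⟨e, f, he, hf, hΦ⟩ := h
  have key : ∀ {p : ℕ} {e : Fin r → EuclideanSpace ℂ (Fin p)}, Orthonormal ℂ e →
      (Matrix.of fun i s => e s i)ᴴ * (Matrix.of fun i s => e s i) = 1 := by
    intro p e he
    ext s t
    have := orthonormal_iff_ite.mp he s t
    rw [PiLp.inner_apply] at this
    simpa [Matrix.mul_apply, Matrix.one_apply, mul_comm] using this
  refine ⟨Matrix.of fun i s => e s i, Matrix.of fun i s => f s i, key he, key hf, ?_⟩
  ext ⟨i, j⟩
  rw [hΦ]
  simp [tensorVec, Matrix.mul_apply, Finset.mul_sum, mul_assoc]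

lemma dephase_sum {m d n : ℕ} [NeZero m] {ι : Type*} [Fintype ι] (B : BasisSet m d)
    (σ : ι → BiOp d n) : dephase B (∑ i, σ i) = ∑ i, dephase B (σ i) := by
  simp only [dephase, Finset.mul_sum, Finset.sum_mul]
  exact Finset.sum_comm

lemma sandwich_ketbra_tensorVec {m d n : ℕ} [NeZero m] (B : BasisSet m d) (a : Component B)
    (M : Matrix (Fin d) (Fin n) ℂ) :
    (componentProj B a ⊗ₖ (1 : Matrix (Fin n) (Fin n) ℂ)) * ketbra (tensorVec M) *
      (componentProj B a ⊗ₖ (1 : Matrix (Fin n) (Fin n) ℂ)) =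
        ketbra (tensorVec (componentProj B a * M)) := by
  have h := mul_ketbra_mul_conjTranspose
    (componentProj B a ⊗ₖ (1 : Matrix (Fin n) (Fin n) ℂ)) (tensorVec M)
  rwa [kronecker_mulVec_tensorVec, Matrix.conjTranspose_kronecker, conjTranspose_componentProj,
    Matrix.conjTranspose_one, Matrix.transpose_one, Matrix.mul_one] at h

lemma dephase_ketbra_tensorVec {m d n : ℕ} [NeZero m] (B : BasisSet m d)
    (M : Matrix (Fin d) (Fin n) ℂ) :
    dephase B (ketbra (tensorVec M)) = ∑ a, ketbra (tensorVec (componentProj B a * M)) :=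
  Finset.sum_congr rfl fun a _ => sandwich_ketbra_tensorVec B a M

/-- A zero-uncertainty state whose Schmidt number is at most the minimum component rank is one
with least entanglement. -/
theorem IsZUS.isZUSLE_of_mem_schmidtCone {m d n : ℕ} [NeZero m] {B : BasisSet m d} {ρ : BiOp d n}
    (hρ : IsZUS B ρ) (h : ρ ∈ schmidtCone d n (minRank B)) : IsZUSLE B ρ := by
  obtain ⟨N, f, hf, rfl⟩ := exists_sum_eq_of_mem_closure h
  choose M hM hfM using hf
  obtain rfl : f = fun i => ketbra (tensorVec (M i)) := funext hfM
  -- The structure theorem holds for any decomposition of the ZUS, in particular for this one into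
  -- terms of low Schmidt rank.
  have key : ∀ i, M i = 0 ∨ ∃ a, componentRank B a = minRank B ∧ componentProj B a * M i = M i ∧
      ∀ b, b ≠ a → componentProj B b * M i = 0 := by
    intro i
    obtain ⟨c, hc⟩ := hρ.exists_mulVec_eq_smul i
    exact or_iff_not_imp_left.mpr (exists_componentProj_mul_eq hc (hM i))
  refine ⟨hρ, ?_, fun b hb => ?_⟩
  · rw [dephase_sum]
    refine Finset.sum_congr rfl fun i _ => ?_
    rw [dephase_ketbra_tensorVec]
    rcases key i with h0 | ⟨a, -, ha, hne⟩
    · simp [h0]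
    · rw [Finset.sum_eq_single a (fun b _ hb => by simp [hne b hb]) (by simp), ha]
  · rw [componentWeight, Finset.sum_mul, Matrix.trace_sum]
    refine Finset.sum_eq_zero fun i _ => ?_
    have h0 : componentProj B b * M i = 0 := by
      rcases key i with h0 | ⟨a, har, -, hne⟩
      · rw [h0, Matrix.mul_zero]
      · refine hne b ?_
        rintro rfl
        exact hb.ne' har
    rw [trace_ketbra_mul, kronecker_mulVec_tensorVec, h0, Matrix.zero_mul, tensorVec_zero,
      dotProduct_zero]

lemma ketbra_mem_schmidtCone_of_isMaxEntangled {p q r : ℕ} {Φ : Fin p × Fin q → ℂ}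
    (h : IsMaxEntangled r Φ) : ketbra Φ ∈ schmidtCone p q r := by
  obtain ⟨X, Y, -, -, rfl⟩ := h.exists_isometries
  refine AddSubmonoid.subset_closure ⟨_, ?_, rfl⟩
  rw [Matrix.mul_assoc]
  exact (Matrix.rank_mul_le_left _ _).trans ((Matrix.rank_le_card_width X).trans (by simp))

end

section

/-! ### Creating states by local operations -/

lemma CanCreate.refl {p q : ℕ} (σ : BiOp p q) : CanCreate σ σ := ⟨LinearMap.id, .done, rfl⟩

lemma CanCreate.alice {p q p' q' r n t : ℕ} (K : Fin n → Fin t → Matrix (Fin r) (Fin p) ℂ)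
    (hK : ∑ k, ∑ l, (K k l)ᴴ * K k l = 1) {σ : BiOp p q} {τ : Fin n → BiOp p' q'}
    (h : ∀ k, CanCreate (∑ l, krausMap (K k l ⊗ₖ (1 : Matrix (Fin q) (Fin q) ℂ)) σ) (τ k)) :
    CanCreate σ (∑ k, τ k) := by
  choose Λ hΛ hτ using h
  refine ⟨_, IsLOCC.alice K hK Λ hΛ, ?_⟩
  simp [LinearMap.sum_apply, ← hτ]

lemma CanCreate.bob {p q p' q' r n t : ℕ} (K : Fin n → Fin t → Matrix (Fin r) (Fin q) ℂ)
    (hK : ∑ k, ∑ l, (K k l)ᴴ * K k l = 1) {σ : BiOp p q} {τ : Fin n → BiOp p' q'}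
    (h : ∀ k, CanCreate (∑ l, krausMap ((1 : Matrix (Fin p) (Fin p) ℂ) ⊗ₖ K k l) σ) (τ k)) :
    CanCreate σ (∑ k, τ k) := by
  choose Λ hΛ hτ using h
  refine ⟨_, IsLOCC.bob K hK Λ hΛ, ?_⟩
  simp [LinearMap.sum_apply, ← hτ]

/-- The adjoint of an isometry can be completed to a channel. -/
lemma exists_kraus_of_isometry {p r : ℕ} [NeZero r] {X : Matrix (Fin p) (Fin r) ℂ}
    (hX : Xᴴ * X = 1) :
    ∃ K : Fin (p + 1) → Matrix (Fin r) (Fin p) ℂ, ∑ l, (K l)ᴴ * K l = 1 ∧ K 0 * X = 1 ∧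
      ∀ j : Fin p, K j.succ * X = 0 := by
  -- `Xᴴ` inverts `X` on its range. The other operators send the orthogonal complement of the range
  -- to the basis vector `0`, which exists because `r ≠ 0`.
  refine ⟨Fin.cons Xᴴ fun j => Matrix.single (0 : Fin r) j (1 : ℂ) * (1 - X * Xᴴ),
    ?_, by simpa using hX, ?_⟩
  · have h1 : (1 - X * Xᴴ) * (1 - X * Xᴴ) = 1 - X * Xᴴ := by
      have : X * Xᴴ * (X * Xᴴ) = X * Xᴴ := by
        rw [Matrix.mul_assoc, ← Matrix.mul_assoc Xᴴ, hX, Matrix.one_mul]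
      simp [mul_sub, sub_mul, this]
    have h2 : (1 - X * Xᴴ)ᴴ = 1 - X * Xᴴ := by simp
    have h3 : ∑ j : Fin p, Matrix.single j j (1 : ℂ) = 1 := by
      ext a b
      simp [Matrix.sum_apply, Matrix.single_apply, Matrix.one_apply, ite_and]
    have h4 : ∀ j : Fin p, (Matrix.single (0 : Fin r) j (1 : ℂ) * (1 - X * Xᴴ))ᴴ *
        (Matrix.single (0 : Fin r) j (1 : ℂ) * (1 - X * Xᴴ)) =
          (1 - X * Xᴴ) * (Matrix.single j j (1 : ℂ) * (1 - X * Xᴴ)) := by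
      intro j
      rw [Matrix.conjTranspose_mul, h2, Matrix.conjTranspose_single, Matrix.mul_assoc,
        ← Matrix.mul_assoc (Matrix.single j 0 _), Matrix.single_mul_single_same]
      simp
    rw [Fin.sum_univ_succ]
    simp only [Fin.cons_zero, Fin.cons_succ, h4, ← Finset.mul_sum, ← Finset.sum_mul, h3,
      Matrix.one_mul, h1, Matrix.conjTranspose_conjTranspose]
    simp
  · intro j
    rw [Fin.cons_succ, Matrix.mul_assoc, Matrix.sub_mul, Matrix.mul_assoc, hX]
    simp

/-- Alice can undo an isometry by a channel. This compresses the given `Φ`, in spaces of any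
dimension, to the standard state on `ℂ^r ⊗ ℂ^r`. -/
lemma CanCreate.of_isometry_left {p q r p' q' : ℕ} [NeZero r] {X : Matrix (Fin p) (Fin r) ℂ}
    (hX : Xᴴ * X = 1) {Z : Matrix (Fin r) (Fin q) ℂ} {τ : BiOp p' q'}
    (h : CanCreate (ketbra (tensorVec Z)) τ) : CanCreate (ketbra (tensorVec (X * Z))) τ := by
  obtain ⟨K, hK, h0, h1⟩ := exists_kraus_of_isometry hX
  have := CanCreate.alice (n := 1) (σ := ketbra (tensorVec (X * Z))) (τ := fun _ => τ)
    (fun _ => K) (by simpa using hK) ?_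
  · simpa using this
  · intro _
    convert h using 1
    simp [krausMap_ketbra, kronecker_mulVec_tensorVec, Fin.sum_univ_succ, ← Matrix.mul_assoc, h0,
      h1]

lemma CanCreate.of_isometry_right {p q r p' q' : ℕ} [NeZero r] {Y : Matrix (Fin q) (Fin r) ℂ}
    (hY : Yᴴ * Y = 1) {Z : Matrix (Fin p) (Fin r) ℂ} {τ : BiOp p' q'}
    (h : CanCreate (ketbra (tensorVec Z)) τ) : CanCreate (ketbra (tensorVec (Z * Yᵀ))) τ := by
  obtain ⟨K, hK, h0, h1⟩ := exists_kraus_of_isometry hY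
  have := CanCreate.bob (n := 1) (σ := ketbra (tensorVec (Z * Yᵀ))) (τ := fun _ => τ)
    (fun _ => K) (by simpa using hK) ?_
  · simpa using this
  · intro _
    convert h using 1
    simp [krausMap_ketbra, kronecker_mulVec_tensorVec, Fin.sum_univ_succ, Matrix.mul_assoc,
      ← Matrix.transpose_mul, h0, h1]

lemma canCreate_isometry_right {p q r : ℕ} {U : Matrix (Fin q) (Fin r) ℂ} (hU : Uᴴ * U = 1)
    (Z : Matrix (Fin p) (Fin r) ℂ) :
    CanCreate (ketbra (tensorVec Z)) (ketbra (tensorVec (Z * Uᵀ))) := by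
  have := CanCreate.bob (n := 1) (t := 1) (σ := ketbra (tensorVec Z))
    (τ := fun _ => ketbra (tensorVec (Z * Uᵀ))) (fun _ _ => U) (by simpa using hU) ?_
  · simpa using this
  · intro _
    convert CanCreate.refl _ using 1
    simp [krausMap_ketbra, kronecker_mulVec_tensorVec]

/-- The cone generated by the maximally entangled pure states of Schmidt rank `r`. -/
def maxEntangledCone (p q r : ℕ) : AddSubmonoid (BiOp p q) :=
  AddSubmonoid.closure {σ | ∃ (V : Matrix (Fin p) (Fin r) ℂ) (U : Matrix (Fin q) (Fin r) ℂ) (x : ℝ),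
    Vᴴ * V = 1 ∧ Uᴴ * U = 1 ∧ 0 ≤ x ∧ σ = (x : ℂ) • ketbra (tensorVec (V * Uᵀ))}

lemma trace_ketbra_isometries {p q r : ℕ} {V : Matrix (Fin p) (Fin r) ℂ}
    {U : Matrix (Fin q) (Fin r) ℂ} (hV : Vᴴ * V = 1) (hU : Uᴴ * U = 1) :
    (ketbra (tensorVec (V * Uᵀ))).trace = r := by
  have h : Uᵀ * Uᵀᴴ = 1 := by
    rw [← Matrix.transpose_one, ← hU, Matrix.transpose_mul]
    rfl
  rw [trace_ketbra_tensorVec, Matrix.conjTranspose_mul, Matrix.mul_assoc, ← Matrix.mul_assoc Uᵀ, h,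
    Matrix.one_mul, Matrix.trace_mul_comm, hV]
  simp

/-- Mixtures of maximally entangled states are created from one of the same Schmidt rank. -/
lemma canCreate_of_mem_maxEntangledCone {p q r : ℕ} [NeZero r] {σ : BiOp p q}
    (hσ : σ ∈ maxEntangledCone p q r) (htr : σ.trace = 1) :
    CanCreate (ketbra (tensorVec
      (((Real.sqrt r : ℝ) : ℂ)⁻¹ • (1 : Matrix (Fin r) (Fin r) ℂ)))) σ := by
  obtain ⟨N, f, hf, rfl⟩ := exists_sum_eq_of_mem_closure hσ
  choose V U x hV hU hx hf using hf
  have hr : (0 : ℝ) < r := Nat.cast_pos.mpr (NeZero.pos r)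
  -- The vector of `V i * (U i)ᵀ` has squared norm `r`, so term `i` has probability `x i * r`.
  have hsum : ∑ i, x i * r = 1 := by
    have h : ∑ i, (x i : ℂ) * r = 1 := by
      rw [← htr, Matrix.trace_sum]
      refine Finset.sum_congr rfl fun i _ => ?_
      rw [hf, Matrix.trace_smul, trace_ketbra_isometries (hV i) (hU i), smul_eq_mul]
    exact_mod_cast h
  have hsq : ∀ i, ((Real.sqrt (x i * r) : ℝ) : ℂ) * ((Real.sqrt (x i * r) : ℝ) : ℂ) =
      ((x i * r : ℝ) : ℂ) := fun i => by
    rw [← Complex.ofReal_mul, Real.mul_self_sqrt (mul_nonneg (hx i) hr.le)]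
  -- One instrument both draws `i` with probability `x i * r` and applies `V i`; its completeness is
  -- `hsum`.
  refine CanCreate.alice (t := 1) (fun i _ => ((Real.sqrt (x i * r) : ℝ) : ℂ) • V i) ?_ fun i => ?_
  · simp only [Finset.univ_unique, Finset.sum_singleton, Matrix.conjTranspose_smul,
      Matrix.smul_mul, Matrix.mul_smul, smul_smul, hV, RCLike.star_def, Complex.conj_ofReal, hsq,
      ← Finset.sum_smul]
    rw [← Complex.ofReal_sum, hsum, Complex.ofReal_one, one_smul]
  · have h1 : (Real.sqrt (x i * r)) * (Real.sqrt r)⁻¹ = Real.sqrt (x i) := by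
      rw [Real.sqrt_mul (hx i), mul_assoc, mul_inv_cancel₀ (Real.sqrt_pos.mpr hr).ne', mul_one]
    have h2 := canCreate_isometry_right (hU i) (((Real.sqrt (x i) : ℝ) : ℂ) • V i)
    convert h2 using 1
    · rw [← h1, Complex.ofReal_mul, Complex.ofReal_inv]
      simp only [Finset.univ_unique, Finset.sum_singleton, krausMap_ketbra,
        kronecker_mulVec_tensorVec, Matrix.transpose_one, Matrix.mul_one, Matrix.mul_smul, smul_smul]
      rw [mul_comm]
    · have h3 : tensorVec (((Real.sqrt (x i) : ℝ) : ℂ) • V i * (U i)ᵀ) =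
          ((Real.sqrt (x i) : ℝ) : ℂ) • tensorVec (V i * (U i)ᵀ) := by
        rw [Matrix.smul_mul]
        rfl
      rw [hf, h3, ketbra_smul, RCLike.star_def, Complex.conj_ofReal, ← Complex.ofReal_mul,
        Real.mul_self_sqrt (hx i)]

/-- With `W = Vᴴ * N` one has `N = V * W` and `W * Wᴴ = c • 1`. For `c ≠ 0`, rescaling `Wᵀ` by `1 /
√c` gives Bob's isometry; for `c = 0` the vector vanishes. -/
lemma ketbra_mem_maxEntangledCone {p q r : ℕ} [NeZero r] {V : Matrix (Fin p) (Fin r) ℂ}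
    (hV : Vᴴ * V = 1) {N : Matrix (Fin p) (Fin q) ℂ} {c : ℂ} (hN : V * Vᴴ * N = N)
    (hc : N * Nᴴ = c • (V * Vᴴ)) : ketbra (tensorVec N) ∈ maxEntangledCone p q r := by
  by_cases h0 : c = 0
  · rw [h0, zero_smul, Matrix.self_mul_conjTranspose_eq_zero] at hc
    rw [hc, tensorVec_zero, ketbra_zero]
    exact zero_mem (maxEntangledCone p q r)
  have hW : (Vᴴ * N) * (Vᴴ * N)ᴴ = c • 1 := by
    rw [Matrix.conjTranspose_mul, Matrix.conjTranspose_conjTranspose, Matrix.mul_assoc,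
      ← Matrix.mul_assoc N, hc, Matrix.smul_mul, Matrix.mul_smul, Matrix.mul_assoc V, hV,
      Matrix.mul_one, hV]
  have hcpos : 0 ≤ c := by
    have h := (Matrix.posSemidef_self_mul_conjTranspose (Vᴴ * N)).diag_nonneg (i := 0)
    rw [hW] at h
    simpa using h
  obtain ⟨x, hx, rfl⟩ : ∃ x : ℝ, 0 ≤ x ∧ (x : ℂ) = c :=
    ⟨c.re, (Complex.nonneg_iff.mp hcpos).1, Complex.ext rfl (Complex.nonneg_iff.mp hcpos).2⟩
  have hx0 : 0 < x := hx.lt_of_ne fun h => h0 (by simp [← h])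
  have hsq : ((Real.sqrt x : ℝ) : ℂ) * ((Real.sqrt x : ℝ) : ℂ) = x := by
    rw [← Complex.ofReal_mul, Real.mul_self_sqrt hx]
  have hs0 : ((Real.sqrt x : ℝ) : ℂ) ≠ 0 := by
    exact_mod_cast (Real.sqrt_pos.mpr hx0).ne'
  refine AddSubmonoid.subset_closure
    ⟨V, ((Real.sqrt x : ℝ) : ℂ)⁻¹ • (Vᴴ * N)ᵀ, x, hV, ?_, hx, ?_⟩
  · have h1 : ((Vᴴ * N)ᵀ)ᴴ * (Vᴴ * N)ᵀ = (x : ℂ) • 1 := by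
      have := congrArg Matrix.transpose hW
      rw [Matrix.transpose_mul, Matrix.transpose_smul, Matrix.transpose_one] at this
      exact this
    rw [Matrix.conjTranspose_smul, Matrix.smul_mul, Matrix.mul_smul, h1, smul_smul, smul_smul,
      star_inv₀, RCLike.star_def, Complex.conj_ofReal, ← hsq]
    field_simp
    simp
  · have h1 : tensorVec (V * (((Real.sqrt x : ℝ) : ℂ)⁻¹ • (Vᴴ * N)ᵀ)ᵀ) =
        ((Real.sqrt x : ℝ) : ℂ)⁻¹ • tensorVec N := by
      rw [Matrix.transpose_smul, Matrix.transpose_transpose, Matrix.mul_smul, ← Matrix.mul_assoc,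
        hN]
      rfl
    rw [h1, ketbra_smul, smul_smul, star_inv₀, RCLike.star_def, Complex.conj_ofReal, ← hsq]
    field_simp
    simp

/-- By cyclicity the weight is the trace of the compressed operator, and a positive semidefinite
operator of trace zero is zero. -/
lemma sandwich_componentProj_eq_zero {m d n : ℕ} [NeZero m] {B : BasisSet m d} {ρ : BiOp d n}
    (hρ : ρ.PosSemidef) {a : Component B} (h : componentWeight B ρ a = 0) :
    (componentProj B a ⊗ₖ (1 : Matrix (Fin n) (Fin n) ℂ)) * ρ *
      (componentProj B a ⊗ₖ (1 : Matrix (Fin n) (Fin n) ℂ)) = 0 := by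
  set Q := componentProj B a ⊗ₖ (1 : Matrix (Fin n) (Fin n) ℂ) with hQ
  have hQH : Qᴴ = Q := by
    rw [hQ, Matrix.conjTranspose_kronecker, conjTranspose_componentProj, Matrix.conjTranspose_one]
  have hQQ : Q * Q = Q := by
    rw [hQ, ← Matrix.mul_kronecker_mul, componentProj_mul_self, Matrix.one_mul]
  have hps : (Q * ρ * Q).PosSemidef := by
    have := hρ.mul_mul_conjTranspose_same Q
    rwa [hQH] at this
  rw [← hps.trace_eq_zero_iff, Matrix.mul_assoc, Matrix.trace_mul_comm, Matrix.mul_assoc, hQQ]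
  exact h

/-- A zero-uncertainty state with least entanglement is a mixture of maximally entangled states
whose Schmidt rank is the minimum component rank. -/
theorem IsZUSLE.mem_maxEntangledCone {m d n : ℕ} [NeZero m] {B : BasisSet m d} {ρ : BiOp d n}
    (h : IsZUSLE B ρ) : ρ ∈ maxEntangledCone d n (minRank B) := by
  obtain ⟨hZ, hdeph, hweight⟩ := h
  have hps := hZ.1.1
  obtain ⟨M, hM⟩ := exists_eq_sum_ketbra hps
  -- Economy of `ρ` allows each diagonal block to be treated separately.
  rw [hdeph, dephase]
  refine sum_mem fun a _ => ?_
  rcases (minRank_le B a).lt_or_eq with ha | ha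
  · rw [sandwich_componentProj_eq_zero hps (hweight a ha)]
    exact zero_mem _
  · have : NeZero (minRank B) := ⟨ha ▸ (componentRank_pos B a).ne'⟩
    obtain ⟨V, hV, hVV⟩ : ∃ V : Matrix (Fin d) (Fin (minRank B)) ℂ,
        Vᴴ * V = 1 ∧ V * Vᴴ = componentProj B a := by
      rw [ha]
      exact exists_isometry_componentProj B a
    rw [hM, Finset.mul_sum, Finset.sum_mul]
    refine sum_mem fun i _ => ?_
    rw [sandwich_ketbra_tensorVec]
    obtain ⟨c, hc⟩ := (hM ▸ hZ).exists_mulVec_eq_smul i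
    refine ketbra_mem_maxEntangledCone (c := c a) hV ?_ ?_
    · rw [hVV, ← Matrix.mul_assoc, componentProj_mul_self]
    · rw [hVV, Matrix.conjTranspose_mul, conjTranspose_componentProj, ← Matrix.mul_assoc,
        Matrix.mul_assoc _ (M i), componentProj_mul_eq_smul hc, Matrix.smul_mul,
        componentProj_mul_self]

/-- Ensures that `minRank` is attained, hence positive: an infimum over no components would be `0`.
In dimension `0` the trace cannot be `1`. -/
lemma nonempty_component_of_isState {m d n : ℕ} [NeZero m] (B : BasisSet m d) {ρ : BiOp d n}
    (h : IsState ρ) : Nonempty (Component B) := by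
  rcases d with _ | d
  · simpa [Matrix.trace] using h.2
  · exact ⟨(transitionGraph B).connectedComponentMk (0, 0)⟩

end

end ZeroUncertainty

open ZeroUncertainty in
theorem corollary4 {m d n : ℕ} [NeZero m] (B : BasisSet m d) (ρ : BiOp d n) (hρ : IsZUS B ρ)
    {p q : ℕ} (Φ : Fin p × Fin q → ℂ) (hΦ : IsMaxEntangled (minRank B) Φ) :
    IsZUSLE B ρ ↔ CanCreate (ketbra Φ) ρ := by
  constructor
  · intro h
    have : Nonempty (Component B) := nonempty_component_of_isState B hρ.1
    obtain ⟨a, ha⟩ := exists_componentRank_eq_minRank B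
    have : NeZero (minRank B) := ⟨ha ▸ (componentRank_pos B a).ne'⟩
    obtain ⟨X, Y, hX, hY, rfl⟩ := hΦ.exists_isometries
    rw [Matrix.mul_assoc]
    exact (canCreate_of_mem_maxEntangledCone h.mem_maxEntangledCone hρ.1.2).of_isometry_right hY
      |>.of_isometry_left hX
  · rintro ⟨Λ, hΛ, rfl⟩
    exact hρ.isZUSLE_of_mem_schmidtCone
      (hΛ.map_mem_schmidtCone (ketbra_mem_schmidtCone_of_isMaxEntangled hΦ))
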